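/- Let $n\ge 4$, let $1<p_1,\dots,p_n\le\infty$ and let $0<p<\infty$ with $\frac1{p_1}+\dots+\frac1{p_n}=\frac1p$. Then there exist a non-degenerate subspace $\Gamma\subseteq\mathbb R^n$ of dimension $n-1$ and a symbol $m\in\mathcal M_\Gamma(\mathbb R^n)$ such that the $n$-linear multiplier operator $T_m$ does not map $L^{p_1}(\mathbb R)\times\dots\times L^{p_n}(\mathbb R)$ into $L^p(\mathbb R)$; that is, there is no constant $C$ such that $$\|T_m(f_1,\dots,f_n)\|_{L^p}\le C\,\|f_1\|_{L^{p_1}}\cdots\|f_n\|_{L^{p_n}}$$ for all Schwartz functions $f_1,\dots,f_n:\mathbb R\to\mathbb C$. Here: (i) a $k$-dimensional subspace $\Gamma\subseteq\mathbb R^n$ is non-degenerate if for any $k$ of the $n+1$ linear functionals $\xi_1,\dots,\xi_n,\ \xi_{n+1}:=-(\xi_1+\dots+\xi_n)$ the map $\Gamma\to\mathbb R^k$ that they define is a bijection; (ii) $\mathcal M_\Gamma(\mathbb R^n)$ is the class of bounded measurable functions $m:\mathbb R^n\to\mathbb C$ that are smooth on $\mathbb R^n\setminus\Gamma$ and satisfy,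 for every multi-index $\gamma$, $|\partial^\gamma m(\eta)|\le C_\gamma\,\operatorname{dist}(\eta,\Gamma)^{-|\gamma|}$ for all $\eta\in\mathbb R^n\setminus\Gamma$; (iii) $T_m(f_1,\dots,f_n)(x)=\int_{\mathbb R^n}m(\xi)\,\widehat{f_1}(\xi_1)\cdots\widehat{f_n}(\xi_n)\,e^{2\pi i x(\xi_1+\dots+\xi_n)}\,d\xi$ for $x\in\mathbb R$, with $\widehat f(\xi)=\int_{\mathbb R}f(x)e^{-2\pi i x\xi}\,dx$. -/

import Mathlib

open MeasureTheory
open scoped SchwartzMap FourierTransform ENNReal NNReal ContDiff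

noncomputable section

/-- The `n + 1` frequencies `(ξ₁, …, ξₙ, -(ξ₁ + ⋯ + ξₙ))` of the `(n + 1)`-linear form attached to an
`n`-linear multiplier operator; they sum to zero. -/
def formFrequencies {n : ℕ} (ξ : EuclideanSpace ℝ (Fin n)) : Fin (n + 1) → ℝ :=
  Fin.snoc (fun i => ξ i) (-∑ i, ξ i)

/-- A subspace `Γ` of `ℝⁿ` of dimension `k` is non-degenerate if, regarded as a subspace of the
hyperplane `ξ₁ + ⋯ + ξₙ₊₁ = 0` of `ℝⁿ⁺¹`, it is a graph over any `k` of the variables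
`ξ₁, …, ξₙ₊₁`: the projection of `Γ` to these `k` variables is a bijection onto `ℝᵏ`. -/
def IsNonDegenerate {n : ℕ} (Γ : Submodule ℝ (EuclideanSpace ℝ (Fin n))) : Prop :=
  ∀ s : Finset (Fin (n + 1)), s.card = Module.finrank ℝ Γ →
    Function.Bijective (fun (ξ : Γ) (i : s) => formFrequencies (ξ : EuclideanSpace ℝ (Fin n)) i)

/-- The Marcinkiewicz–Hörmander–Mikhlin symbols on `ℝⁿ` that are singular along `Γ`: bounded
(measurable) functions, smooth off `Γ`, with `|∂^γ m(η)| ≲ dist(η, Γ)^(-|γ|)` for all multi-indices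
`γ`. The derivatives of order `k` are bounded together, through the norm of the `k`-th Fréchet
derivative. -/
structure IsMikhlinSymbol {n : ℕ} (Γ : Submodule ℝ (EuclideanSpace ℝ (Fin n)))
    (m : EuclideanSpace ℝ (Fin n) → ℂ) : Prop where
  aestronglyMeasurable : AEStronglyMeasurable m volume
  bounded : ∃ C : ℝ, ∀ η, ‖m η‖ ≤ C
  smooth : ContDiffOn ℝ ∞ m ((Γ : Set (EuclideanSpace ℝ (Fin n)))ᶜ)
  decay : ∀ k : ℕ, ∃ C : ℝ, ∀ η ∉ Γ,
    ‖iteratedFDeriv ℝ k m η‖ ≤ C / (Metric.infDist η (Γ : Set (EuclideanSpace ℝ (Fin n)))) ^ k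

/-- The `n`-linear multiplier operator `T_m` on Schwartz functions:
`T_m(f₁, …, fₙ)(x) = ∫ m(ξ) f̂₁(ξ₁) ⋯ f̂ₙ(ξₙ) e^{2πix(ξ₁ + ⋯ + ξₙ)} dξ`, where
`f̂(ξ) = ∫ f(x) e^{-2πixξ} dx`. -/
def multiplierOperator {n : ℕ} (m : EuclideanSpace ℝ (Fin n) → ℂ) (f : Fin n → 𝓢(ℝ, ℂ))
    (x : ℝ) : ℂ :=
  ∫ ξ : EuclideanSpace ℝ (Fin n), m ξ * (∏ i, 𝓕 (f i : ℝ → ℂ) (ξ i)) *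
    Complex.exp (2 * Real.pi * Complex.I * x * ((∑ i, ξ i : ℝ) : ℂ))

/-- `T_m` maps `L^{p₁} × ⋯ × L^{pₙ}` into `L^q`: the a priori estimate
`‖T_m(f₁, …, fₙ)‖_q ≤ C ‖f₁‖_{p₁} ⋯ ‖fₙ‖_{pₙ}` holds for all Schwartz functions, with a constant
`C` that does not depend on them. -/
def MapsLebesgue {n : ℕ} (m : EuclideanSpace ℝ (Fin n) → ℂ) (p : Fin n → ℝ≥0∞) (q : ℝ≥0∞) : Prop :=
  ∃ C : ℝ≥0, ∀ f : Fin n → 𝓢(ℝ, ℂ),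
    eLpNorm (multiplierOperator m f) q volume ≤ C * ∏ i, eLpNorm (f i : ℝ → ℂ) (p i) volume

end

/-! The singular space is `Γ = α^⊥`, where `α` has distinct nonzero entries summing to zero. For `Re
v = 1` and `z = v⁻¹`, so that `Re z = ‖z‖²`, the symbol is `exp(-π (α·ξ)²)` times the chirps `exp(-π
z̄ ξ_j²)` and `exp(-π z (∑ ξ_j)²)`. The chirps live on `|ξ_j| ≲ 1/‖z‖`, where their phases have
bounded derivatives, so the Mikhlin constants do not depend on `v` (`hasBoundedDerivs_chirpSymbol`).

Test on `f_j = exp(-π v x²)`. Since `|f_j| = exp(-π x²)`, all norms of the inputs are independent of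
`v`. The Fourier transforms are chirps that the symbol turns into positive Gaussians of width about
`‖v‖`, and the output is computed exactly (`multiplierOperator_chirpSymbol`). Its modulus is at
least a constant times `‖v‖^((n-3)/2)` times a fixed Gaussian. For `n ≥ 4` this is unbounded in `v`,
whatever the exponents (`exists_le_norm_multiplierOperator_chirpSymbol`).

A single bad symbol comes from a Baire argument on `ℕ → Bool`: if every superposition `∑ c_i 2⁻ⁱ
m_i` satisfied an estimate, the constants of the `m_i` would be `O(2^i)`
(`exists_bound_of_mapsLebesgue_superposition`). The choice `v_i = 1 + 16^i I` forces growth of at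
least `4^i`. -/

/-! ### Complex Gaussians -/

/-- The complex Gaussian `exp (-π z y²)`. -/
noncomputable def gaussianExp (z : ℂ) (y : ℝ) : ℂ := Complex.exp (-Real.pi * z * (y : ℂ) ^ 2)

lemma norm_gaussianExp (z : ℂ) (y : ℝ) :
    ‖gaussianExp z y‖ = Real.exp (-Real.pi * z.re * y ^ 2) := by
  rw [gaussianExp, Complex.norm_exp]
  congr 1
  rw [← Complex.ofReal_neg, ← Complex.ofReal_pow, Complex.re_mul_ofReal, Complex.re_ofReal_mul]

lemma contDiff_gaussianExp (z : ℂ) : ContDiff ℝ ∞ (gaussianExp z) := by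
  unfold gaussianExp
  exact ((contDiff_const (c := (-Real.pi * z : ℂ))).mul
    (Complex.ofRealCLM.contDiff.pow 2)).cexp

/-- The cross term `2 y Re(z w)` is absorbed by half of the decay `Re z · y²`. The price `‖z‖² / Re
z` in the exponent stays bounded in the regime `‖z‖² ≤ Re z` of the chirps. -/
lemma norm_cexp_gaussian_add_le {z : ℂ} (hz : 0 < z.re) (y : ℝ) {w : ℂ} (hw : ‖w‖ ≤ 1) :
    ‖Complex.exp (-Real.pi * z * (y + w) ^ 2)‖ ≤
      Real.exp (2 * Real.pi * ‖z‖ ^ 2 / z.re + Real.pi * ‖z‖) *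
        Real.exp (-(Real.pi * z.re / 2) * y ^ 2) := by
  rw [Complex.norm_exp, ← Real.exp_add, Real.exp_le_exp]
  have h1 : (-Real.pi * z * (y + w) ^ 2 : ℂ).re =
      Real.pi * (-z.re * y ^ 2 - 2 * y * (z * w).re - (z * w ^ 2).re) := by
    have : (-Real.pi * z * (y + w) ^ 2 : ℂ) =
        (Real.pi : ℂ) * (-(z * ((y ^ 2 : ℝ) : ℂ)) - ((2 * y : ℝ) : ℂ) * (z * w) - z * w ^ 2) := by
      push_cast; ring
    rw [this, Complex.re_ofReal_mul, Complex.sub_re, Complex.sub_re, Complex.re_ofReal_mul,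
      Complex.neg_re, Complex.re_mul_ofReal]
    ring
  have hb1 : |(z * w).re| ≤ ‖z‖ := (Complex.abs_re_le_norm _).trans (by
    rw [norm_mul]; exact mul_le_of_le_one_right (norm_nonneg _) hw)
  have hb2 : |(z * w ^ 2).re| ≤ ‖z‖ := (Complex.abs_re_le_norm _).trans (by
    rw [norm_mul, norm_pow]
    exact mul_le_of_le_one_right (norm_nonneg _) (pow_le_one₀ (norm_nonneg _) hw))
  have h2 : -(2 * y * (z * w).re) ≤ 2 * |y| * ‖z‖ := by
    calc _ ≤ |2 * y * (z * w).re| := neg_le_abs _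
      _ = 2 * |y| * |(z * w).re| := by rw [abs_mul, abs_mul]; norm_num
      _ ≤ _ := by gcongr
  have h3 : 2 * |y| * ‖z‖ ≤ z.re / 2 * y ^ 2 + 2 * ‖z‖ ^ 2 / z.re := by
    have : z.re / 2 * y ^ 2 + 2 * ‖z‖ ^ 2 / z.re - 2 * |y| * ‖z‖ =
        (z.re * |y| - 2 * ‖z‖) ^ 2 / (2 * z.re) := by
      rw [← sq_abs y]; field_simp; ring
    have h : 0 ≤ (z.re * |y| - 2 * ‖z‖) ^ 2 / (2 * z.re) := by positivity
    linarith
  rw [h1]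
  have h4 := neg_le_abs (z * w ^ 2).re
  calc _ ≤ Real.pi * (-z.re * y ^ 2 + (z.re / 2 * y ^ 2 + 2 * ‖z‖ ^ 2 / z.re) + ‖z‖) := by
        apply mul_le_mul_of_nonneg_left _ Real.pi_pos.le
        linarith
    _ = _ := by ring

lemma iteratedDeriv_comp_ofReal {F : ℂ → ℂ} (hF : ContDiff ℂ ∞ F) (k : ℕ) :
    iteratedDeriv k (fun y : ℝ => F y) = fun y : ℝ => iteratedDeriv k F y := by
  induction k with
  | zero => simp
  | succ k ih =>
    rw [iteratedDeriv_succ, ih]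
    funext y
    rw [iteratedDeriv_succ]
    have : DifferentiableAt ℂ (iteratedDeriv k F) y :=
      (hF.differentiable_iteratedDeriv k (by exact_mod_cast WithTop.coe_lt_top _)) y
    exact this.hasDerivAt.comp_ofReal.deriv

/-- Cauchy's estimate for the entire extension on the unit circle around `y`, which keeps the
dependence on `z` explicit. -/
lemma norm_iteratedFDeriv_gaussianExp_le {z : ℂ} (hz : 0 < z.re) (k : ℕ) (y : ℝ) :
    ‖iteratedFDeriv ℝ k (gaussianExp z) y‖ ≤ k.factorial *
      (Real.exp (2 * Real.pi * ‖z‖ ^ 2 / z.re + Real.pi * ‖z‖) *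
        Real.exp (-(Real.pi * z.re / 2) * y ^ 2)) := by
  have hF : ContDiff ℂ ∞ (fun w : ℂ => Complex.exp (-Real.pi * z * w ^ 2)) := by fun_prop
  rw [norm_iteratedFDeriv_eq_norm_iteratedDeriv]
  have := congrFun (iteratedDeriv_comp_ofReal hF k) y
  unfold gaussianExp
  rw [this]
  have h := Complex.norm_iteratedDeriv_le_of_forall_mem_sphere_norm_le (c := (y : ℂ)) (R := 1) k
    one_pos (hF.differentiable (by simp)).diffContOnCl
    (C := Real.exp (2 * Real.pi * ‖z‖ ^ 2 / z.re + Real.pi * ‖z‖) *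
        Real.exp (-(Real.pi * z.re / 2) * y ^ 2)) (fun w hw => by
      have := norm_cexp_gaussian_add_le hz y (w := w - y)
        (by rw [mem_sphere_iff_norm] at hw; exact hw.le)
      rwa [add_sub_cancel] at this)
  simpa using h

lemma exists_pow_mul_exp_neg_sq_le {a : ℝ} (ha : 0 < a) (l : ℕ) :
    ∃ C, ∀ y : ℝ, |y| ^ l * Real.exp (-a * y ^ 2) ≤ C := by
  refine ⟨l.factorial * Real.exp (1 / (4 * a)), fun y => ?_⟩
  have h1 : |y| ^ l ≤ l.factorial * Real.exp |y| := by
    have := Real.pow_div_factorial_le_exp |y| (abs_nonneg _) l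
    rwa [div_le_iff₀' (by positivity)] at this
  calc _ ≤ l.factorial * Real.exp |y| * Real.exp (-a * y ^ 2) := by gcongr
    _ = l.factorial * Real.exp (|y| + -a * y ^ 2) := by rw [mul_assoc, Real.exp_add]
    _ ≤ _ := by
      gcongr
      have : 1 / (4 * a) - (|y| + -a * y ^ 2) = (2 * a * |y| - 1) ^ 2 / (4 * a) := by
        rw [← sq_abs y]; field_simp; ring
      have h : 0 ≤ (2 * a * |y| - 1) ^ 2 / (4 * a) := by positivity
      linarith

lemma exists_pow_mul_norm_iteratedFDeriv_gaussianExp_le {z : ℂ} (hz : 0 < z.re) (l k : ℕ) :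
    ∃ C, ∀ y : ℝ, |y| ^ l * ‖iteratedFDeriv ℝ k (gaussianExp z) y‖ ≤ C := by
  obtain ⟨C, hC⟩ := exists_pow_mul_exp_neg_sq_le (a := Real.pi * z.re / 2) (by positivity) l
  refine ⟨k.factorial * Real.exp (2 * Real.pi * ‖z‖ ^ 2 / z.re + Real.pi * ‖z‖) * C,
    fun y => ?_⟩
  calc _ ≤ |y| ^ l * (k.factorial * (Real.exp (2 * Real.pi * ‖z‖ ^ 2 / z.re + Real.pi * ‖z‖) *
        Real.exp (-(Real.pi * z.re / 2) * y ^ 2))) := by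
        gcongr; exact norm_iteratedFDeriv_gaussianExp_le hz k y
    _ = k.factorial * Real.exp (2 * Real.pi * ‖z‖ ^ 2 / z.re + Real.pi * ‖z‖) *
        (|y| ^ l * Real.exp (-(Real.pi * z.re / 2) * y ^ 2)) := by ring
    _ ≤ _ := by gcongr; exact hC y

/-- The complex Gaussian as a Schwartz function. -/
noncomputable def gaussianSchwartz (z : ℂ) (hz : 0 < z.re) : 𝓢(ℝ, ℂ) where
  toFun := gaussianExp z
  smooth' := contDiff_gaussianExp z
  decay' l k := exists_pow_mul_norm_iteratedFDeriv_gaussianExp_le hz l k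

lemma coe_gaussianSchwartz (z : ℂ) (hz : 0 < z.re) :
    (gaussianSchwartz z hz : ℝ → ℂ) = gaussianExp z := rfl

/-! ### Families of functions with uniformly bounded derivatives -/

/-- The functions `F i` are smooth, and each of their derivatives is bounded, uniformly in `i`,
even after multiplication with any power of the weight `w`. -/
def HasBoundedDerivs {ι E : Type*} [NormedAddCommGroup E] [NormedSpace ℝ E]
    (w : E → ℝ) (F : ι → E → ℂ) : Prop :=
  (∀ i, ContDiff ℝ ∞ (F i)) ∧
    ∀ l k : ℕ, ∃ C, ∀ i x, |w x| ^ l * ‖iteratedFDeriv ℝ k (F i) x‖ ≤ C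

namespace HasBoundedDerivs

variable {ι E E' : Type*} [NormedAddCommGroup E] [NormedSpace ℝ E]
  [NormedAddCommGroup E'] [NormedSpace ℝ E']

lemma const (c : ℂ) : HasBoundedDerivs 1 (fun (_ : ι) (_ : E) => c) := by
  refine ⟨fun _ => contDiff_const, fun l k => ⟨‖c‖, fun i x => ?_⟩⟩
  rcases Nat.eq_zero_or_pos k with rfl | hk
  · simp
  · simp [iteratedFDeriv_const_of_ne hk.ne']

lemma exists_norm_le {w : E → ℝ} {F : ι → E → ℂ} (hF : HasBoundedDerivs w F) (k : ℕ) :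
    ∃ C, ∀ i x, ‖iteratedFDeriv ℝ k (F i) x‖ ≤ C := by
  simpa using hF.2 0 k

lemma mul {w : E → ℝ} {F G : ι → E → ℂ} (hF : HasBoundedDerivs w F)
    (hG : HasBoundedDerivs 1 G) : HasBoundedDerivs w (fun i x => F i x * G i x) := by
  refine ⟨fun i => (hF.1 i).mul (hG.1 i), fun l k => ?_⟩
  choose A hA using hF.2 l
  choose B hB using hG.exists_norm_le
  refine ⟨∑ j ∈ Finset.range (k + 1), (k.choose j : ℝ) * A j * B (k - j), fun i x => ?_⟩
  calc _ ≤ |w x| ^ l * ∑ j ∈ Finset.range (k + 1), (k.choose j : ℝ) *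
        ‖iteratedFDeriv ℝ j (F i) x‖ * ‖iteratedFDeriv ℝ (k - j) (G i) x‖ := by
        gcongr
        exact norm_iteratedFDeriv_mul_le (hF.1 i) (hG.1 i) x (by exact_mod_cast le_top)
    _ = ∑ j ∈ Finset.range (k + 1), (k.choose j : ℝ) *
        (|w x| ^ l * ‖iteratedFDeriv ℝ j (F i) x‖) * ‖iteratedFDeriv ℝ (k - j) (G i) x‖ := by
        rw [Finset.mul_sum]; congr! 1; ring
    _ ≤ _ := by
        have h0 : ∀ j, 0 ≤ A j := fun j => le_trans (by positivity) (hA j i x)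
        gcongr with j
        · have := h0 j; positivity
        · exact hA j i x
        · exact hB _ i x

lemma prod {κ : Type*} (s : Finset κ) {F : κ → ι → E → ℂ}
    (hF : ∀ j ∈ s, HasBoundedDerivs 1 (F j)) :
    HasBoundedDerivs 1 (fun i x => ∏ j ∈ s, F j i x) := by
  classical
  induction s using Finset.induction_on with
  | empty => simpa using const (1 : ℂ)
  | insert a s ha ih =>
    simp_rw [Finset.prod_insert ha]
    exact (hF a (by simp)).mul (ih fun j hj => hF j (by simp [hj]))

lemma comp_continuousLinearMap {w : E → ℝ} {F : ι → E → ℂ} (hF : HasBoundedDerivs w F)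
    (g : E' →L[ℝ] E) : HasBoundedDerivs (w ∘ g) (fun i x => F i (g x)) := by
  refine ⟨fun i => (hF.1 i).comp g.contDiff, fun l k => ?_⟩
  obtain ⟨C, hC⟩ := hF.2 l k
  refine ⟨C * ‖g‖ ^ k, fun i x => ?_⟩
  have h1 : ‖iteratedFDeriv ℝ k (F i ∘ g) x‖ ≤ ‖iteratedFDeriv ℝ k (F i) (g x)‖ * ‖g‖ ^ k := by
    rw [g.iteratedFDeriv_comp_right (hF.1 i) x (by exact_mod_cast le_top)]
    simpa using (iteratedFDeriv ℝ k (F i) (g x)).norm_compContinuousLinearMap_le (fun _ => g)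
  calc _ ≤ |w (g x)| ^ l * (‖iteratedFDeriv ℝ k (F i) (g x)‖ * ‖g‖ ^ k) :=
        mul_le_mul_of_nonneg_left h1 (by positivity)
    _ = |w (g x)| ^ l * ‖iteratedFDeriv ℝ k (F i) (g x)‖ * ‖g‖ ^ k := by ring
    _ ≤ _ := by gcongr; exact hC i (g x)

/-- The phase has derivative of size `‖z‖ |y|`, while the modulus confines `y` to `|y| ≲ (Re
z)^(-1/2) ≤ 1/‖z‖`. This makes the bounds uniform in `i`. -/
lemma gaussianExp {z : ι → ℂ} (hz : ∀ i, 0 < (z i).re) (hz' : ∀ i, ‖z i‖ ^ 2 ≤ (z i).re) :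
    HasBoundedDerivs 1 (fun i => gaussianExp (z i)) := by
  refine ⟨fun i => contDiff_gaussianExp _, fun l k =>
    ⟨k.factorial * (Real.exp (3 * Real.pi) * 1), fun i x => ?_⟩⟩
  have h1 : ‖z i‖ ≤ 1 := by
    have h2 := Complex.re_le_norm (z i)
    have h3 := hz' i
    have h4 := hz i
    nlinarith
  simp only [Pi.one_apply, abs_one, one_pow, one_mul]
  refine (norm_iteratedFDeriv_gaussianExp_le (hz i) k x).trans ?_
  gcongr
  · have h2 : 2 * Real.pi * ‖z i‖ ^ 2 / (z i).re ≤ 2 * Real.pi := by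
      rw [div_le_iff₀ (hz i)]
      have := hz' i
      gcongr
    have h3 : Real.pi * ‖z i‖ ≤ Real.pi := mul_le_of_le_one_right Real.pi_pos.le h1
    linarith
  · rw [Real.exp_le_one_iff]
    have := mul_nonneg (mul_pos Real.pi_pos (hz i)).le (sq_nonneg x)
    linarith

/-- This factor alone supplies the weight: composed with `ξ ↦ α·ξ`, it gives arbitrary decay away
from `Γ`. -/
lemma gaussianExp_one : HasBoundedDerivs id (fun _ : ι => _root_.gaussianExp 1) := by
  refine ⟨fun i => contDiff_gaussianExp _, fun l k => ?_⟩
  obtain ⟨C, hC⟩ := exists_pow_mul_norm_iteratedFDeriv_gaussianExp_le (z := 1) (by simp) l k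
  exact ⟨C, fun _ => hC⟩

end HasBoundedDerivs

/-! ### Superpositions of symbols -/

lemma HasBoundedDerivs.tsum {E : Type*} [NormedAddCommGroup E] [NormedSpace ℝ E]
    {w : E → ℝ} {F : ℕ → E → ℂ} (hF : HasBoundedDerivs w F) {a : ℕ → ℂ}
    (ha : Summable fun i => ‖a i‖) :
    HasBoundedDerivs w (fun (_ : Unit) x => ∑' i, a i * F i x) := by
  choose A hA using hF.exists_norm_le
  have hsm : ∀ i, ContDiff ℝ ∞ (fun x => a i * F i x) := fun i => contDiff_const.mul (hF.1 i)
  have hd : ∀ (k i : ℕ) x, iteratedFDeriv ℝ k (fun x => a i * F i x) x =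
      a i • iteratedFDeriv ℝ k (F i) x := fun k i x =>
    iteratedFDeriv_const_smul_apply (a := a i) ((hF.1 i).contDiffAt.of_le (by exact_mod_cast le_top))
  have hb : ∀ (k i : ℕ) x, ‖iteratedFDeriv ℝ k (fun x => a i * F i x) x‖ ≤ ‖a i‖ * A k := by
    intro k i x
    rw [hd, norm_smul]
    gcongr
    exact hA k i x
  have hs : ∀ k : ℕ, Summable fun i => ‖a i‖ * A k := fun k => ha.mul_right _
  refine ⟨fun _ => ?_, fun l k => ?_⟩
  · exact contDiff_tsum (N := ⊤) hsm (fun k _ => hs k) (fun k i x _ => hb k i x)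
  · obtain ⟨C, hC⟩ := hF.2 l k
    refine ⟨∑' i, ‖a i‖ * C, fun _ x => ?_⟩
    rw [iteratedFDeriv_tsum_apply (N := ⊤) hsm (fun k _ => hs k) (fun k i x _ => hb k i x) le_top,
      ← abs_of_nonneg (a := |w x| ^ l) (by positivity), ← Real.norm_eq_abs, ← norm_smul,
      ← tsum_const_smul'']
    refine tsum_of_norm_bounded (ha.mul_right C).hasSum fun i => ?_
    rw [hd, norm_smul, norm_smul, Real.norm_eq_abs, abs_of_nonneg (by positivity), mul_left_comm]
    gcongr
    exact hC i x

lemma HasBoundedDerivs.isMikhlinSymbol {ι : Type*} {n : ℕ} {w : EuclideanSpace ℝ (Fin n) → ℝ}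
    {F : ι → EuclideanSpace ℝ (Fin n) → ℂ} (hF : HasBoundedDerivs w F) (i : ι)
    {Γ : Submodule ℝ (EuclideanSpace ℝ (Fin n))}
    (hΓ : ∀ ξ, Metric.infDist ξ (Γ : Set (EuclideanSpace ℝ (Fin n))) ≤ |w ξ|) :
    IsMikhlinSymbol Γ (F i) where
  aestronglyMeasurable := (hF.1 i).continuous.aestronglyMeasurable
  bounded := by
    obtain ⟨C, hC⟩ := hF.exists_norm_le 0
    exact ⟨C, fun η => by simpa using hC i η⟩
  smooth := (hF.1 i).contDiffOn
  decay k := by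
    -- The weight to the power of the order of differentiation dominates `dist(η, Γ) ^ k`.
    obtain ⟨C, hC⟩ := hF.2 k k
    refine ⟨C, fun η hη => ?_⟩
    have hpos : 0 < Metric.infDist η (Γ : Set (EuclideanSpace ℝ (Fin n))) :=
      (Γ.closed_of_finiteDimensional.notMem_iff_infDist_pos ⟨0, Γ.zero_mem⟩).1 hη
    rw [le_div_iff₀' (by positivity)]
    refine le_trans ?_ (hC i η)
    gcongr
    exact hΓ η

/-! ### Multiplier operators with bounded symbols -/

section

variable {n : ℕ}

lemma integrable_prod_fourier (f : Fin n → 𝓢(ℝ, ℂ)) :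
    Integrable fun ξ : EuclideanSpace ℝ (Fin n) => ∏ i, 𝓕 (f i : ℝ → ℂ) (ξ i) := by
  rw [← (PiLp.volume_preserving_toLp (Fin n)).integrable_comp_emb
    (MeasurableEquiv.toLp 2 _).measurableEmbedding]
  refine Integrable.fintype_prod (f := fun i (v : ℝ) => 𝓕 (f i : ℝ → ℂ) v) fun i => ?_
  simpa [SchwartzMap.fourier_coe] using (𝓕 (f i)).integrable

lemma norm_multiplier_phase (x s : ℝ) :
    ‖Complex.exp (2 * Real.pi * Complex.I * x * (s : ℂ))‖ = 1 := by
  rw [show (2 * Real.pi * Complex.I * x * (s : ℂ)) = ((2 * Real.pi * x * s : ℝ) : ℂ) * Complex.I by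
    push_cast; ring]
  exact Complex.norm_exp_ofReal_mul_I _

lemma norm_multiplier_integrand_le {m : EuclideanSpace ℝ (Fin n) → ℂ} {C : ℝ}
    (hC : ∀ ξ, ‖m ξ‖ ≤ C) (f : Fin n → 𝓢(ℝ, ℂ)) (x : ℝ) (ξ : EuclideanSpace ℝ (Fin n)) :
    ‖m ξ * (∏ i, 𝓕 (f i : ℝ → ℂ) (ξ i)) *
      Complex.exp (2 * Real.pi * Complex.I * x * ((∑ i, ξ i : ℝ) : ℂ))‖ ≤
      C * ‖∏ i, 𝓕 (f i : ℝ → ℂ) (ξ i)‖ := by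
  rw [norm_mul, norm_mul, norm_multiplier_phase, mul_one]
  gcongr
  exact hC ξ

lemma aestronglyMeasurable_multiplier_integrand {m : EuclideanSpace ℝ (Fin n) → ℂ}
    (hm : Continuous m) (f : Fin n → 𝓢(ℝ, ℂ)) (x : ℝ) :
    AEStronglyMeasurable (fun ξ : EuclideanSpace ℝ (Fin n) => m ξ * (∏ i, 𝓕 (f i : ℝ → ℂ) (ξ i)) *
      Complex.exp (2 * Real.pi * Complex.I * x * ((∑ i, ξ i : ℝ) : ℂ))) volume :=
  (hm.aestronglyMeasurable.mul (integrable_prod_fourier f).aestronglyMeasurable).mul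
    (Continuous.aestronglyMeasurable (by fun_prop))

lemma integrable_multiplier_integrand {m : EuclideanSpace ℝ (Fin n) → ℂ} {C : ℝ}
    (hm : Continuous m) (hC : ∀ ξ, ‖m ξ‖ ≤ C) (f : Fin n → 𝓢(ℝ, ℂ)) (x : ℝ) :
    Integrable fun ξ : EuclideanSpace ℝ (Fin n) => m ξ * (∏ i, 𝓕 (f i : ℝ → ℂ) (ξ i)) *
      Complex.exp (2 * Real.pi * Complex.I * x * ((∑ i, ξ i : ℝ) : ℂ)) :=
  ((integrable_prod_fourier f).norm.const_mul C).mono'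
    (aestronglyMeasurable_multiplier_integrand hm f x)
    (Filter.Eventually.of_forall fun ξ => norm_multiplier_integrand_le hC f x ξ)

lemma continuous_multiplierOperator {m : EuclideanSpace ℝ (Fin n) → ℂ} {C : ℝ}
    (hm : Continuous m) (hC : ∀ ξ, ‖m ξ‖ ≤ C) (f : Fin n → 𝓢(ℝ, ℂ)) :
    Continuous (multiplierOperator m f) :=
  continuous_of_dominated (fun x => aestronglyMeasurable_multiplier_integrand hm f x)
    (fun x => Filter.Eventually.of_forall fun ξ => norm_multiplier_integrand_le hC f x ξ)
    ((integrable_prod_fourier f).norm.const_mul C)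
    (Filter.Eventually.of_forall fun ξ => by fun_prop)

lemma tendsto_multiplierOperator {M : ℕ → EuclideanSpace ℝ (Fin n) → ℂ}
    {m : EuclideanSpace ℝ (Fin n) → ℂ} {C : ℝ} (hM : ∀ k, Continuous (M k))
    (hC : ∀ k ξ, ‖M k ξ‖ ≤ C) (hlim : ∀ ξ, Filter.Tendsto (M · ξ) Filter.atTop (nhds (m ξ)))
    (f : Fin n → 𝓢(ℝ, ℂ)) (x : ℝ) :
    Filter.Tendsto (fun k => multiplierOperator (M k) f x) Filter.atTop
      (nhds (multiplierOperator m f x)) :=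
  tendsto_integral_of_dominated_convergence _
    (fun k => aestronglyMeasurable_multiplier_integrand (hM k) f x)
    ((integrable_prod_fourier f).norm.const_mul C)
    (fun k => Filter.Eventually.of_forall fun ξ => norm_multiplier_integrand_le (hC k) f x ξ)
    (Filter.Eventually.of_forall fun ξ => ((hlim ξ).mul_const _).mul_const _)

lemma multiplierOperator_sub {m m' : EuclideanSpace ℝ (Fin n) → ℂ} {C C' : ℝ}
    (hm : Continuous m) (hC : ∀ ξ, ‖m ξ‖ ≤ C) (hm' : Continuous m') (hC' : ∀ ξ, ‖m' ξ‖ ≤ C')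
    (f : Fin n → 𝓢(ℝ, ℂ)) :
    multiplierOperator (m - m') f = multiplierOperator m f - multiplierOperator m' f := by
  funext x
  simp only [multiplierOperator, Pi.sub_apply]
  rw [← integral_sub (integrable_multiplier_integrand hm hC f x)
    (integrable_multiplier_integrand hm' hC' f x)]
  simp only [sub_mul]

lemma multiplierOperator_const_smul (c : ℂ) (m : EuclideanSpace ℝ (Fin n) → ℂ)
    (f : Fin n → 𝓢(ℝ, ℂ)) : multiplierOperator (c • m) f = c • multiplierOperator m f := by
  funext x
  simp only [multiplierOperator, Pi.smul_apply, smul_eq_mul, mul_assoc, integral_const_mul]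

/-! ### A uniform boundedness principle -/

/-- The superposition `∑ 2⁻ⁱ mᵢ` over the indices `i` selected by `c`. -/
noncomputable def superposition (m : ℕ → EuclideanSpace ℝ (Fin n) → ℂ) (c : ℕ → Bool)
    (ξ : EuclideanSpace ℝ (Fin n)) : ℂ :=
  ∑' i, (if c i then ((1 : ℂ) / 2) ^ i else 0) * m i ξ

lemma norm_superposition_coeff_le (b : Bool) (i : ℕ) :
    ‖if b then ((1 : ℂ) / 2) ^ i else 0‖ ≤ (1 / 2 : ℝ) ^ i := by
  cases b <;> simp

lemma summable_norm_superposition_coeff (c : ℕ → Bool) :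
    Summable fun i => ‖if c i then ((1 : ℂ) / 2) ^ i else 0‖ :=
  Summable.of_nonneg_of_le (fun _ => norm_nonneg _)
    (fun i => norm_superposition_coeff_le (c i) i) summable_geometric_two

lemma HasBoundedDerivs.superposition {w : EuclideanSpace ℝ (Fin n) → ℝ}
    {m : ℕ → EuclideanSpace ℝ (Fin n) → ℂ} (hm : HasBoundedDerivs w m) (c : ℕ → Bool) :
    HasBoundedDerivs w (fun (_ : Unit) => superposition m c) :=
  hm.tsum (summable_norm_superposition_coeff c)

lemma norm_superposition_term_le {m : ℕ → EuclideanSpace ℝ (Fin n) → ℂ} {A : ℝ}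
    (hA : ∀ i ξ, ‖m i ξ‖ ≤ A) (c : ℕ → Bool) (ξ : EuclideanSpace ℝ (Fin n)) (i : ℕ) :
    ‖(if c i then ((1 : ℂ) / 2) ^ i else 0) * m i ξ‖ ≤ (1 / 2 : ℝ) ^ i * A := by
  rw [norm_mul]
  gcongr
  · exact norm_superposition_coeff_le _ _
  · exact hA i ξ

lemma norm_superposition_le {m : ℕ → EuclideanSpace ℝ (Fin n) → ℂ} {A : ℝ}
    (hA : ∀ i ξ, ‖m i ξ‖ ≤ A) (c : ℕ → Bool) (ξ : EuclideanSpace ℝ (Fin n)) :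
    ‖superposition m c ξ‖ ≤ 2 * A :=
  tsum_of_norm_bounded (hasSum_geometric_two.mul_right A) (norm_superposition_term_le hA c ξ)

lemma continuous_superposition_apply {m : ℕ → EuclideanSpace ℝ (Fin n) → ℂ} {A : ℝ}
    (hA : ∀ i ξ, ‖m i ξ‖ ≤ A) (ξ : EuclideanSpace ℝ (Fin n)) :
    Continuous fun c => superposition m c ξ := by
  refine continuous_tsum (fun i => ?_) (summable_geometric_two.mul_right A)
    (fun i c => norm_superposition_term_le hA c ξ i)
  have h : Continuous fun b : Bool => (if b then ((1 : ℂ) / 2) ^ i else 0) * m i ξ :=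
    continuous_of_discreteTopology
  exact h.comp (continuous_apply i)

/-- Switching one coordinate isolates one symbol, so estimates for superpositions yield estimates
for `m i` at the cost of a factor `2 ^ i`. -/
lemma superposition_update_sub {m : ℕ → EuclideanSpace ℝ (Fin n) → ℂ} {A : ℝ}
    (hA : ∀ i ξ, ‖m i ξ‖ ≤ A) (c : ℕ → Bool) (i : ℕ) :
    superposition m (Function.update c i true) - superposition m (Function.update c i false) =
      ((1 : ℂ) / 2) ^ i • m i := by
  funext ξ
  have hs : ∀ c : ℕ → Bool, Summable fun j => (if c j then ((1 : ℂ) / 2) ^ j else 0) * m j ξ := fun c =>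
    Summable.of_norm_bounded (summable_geometric_two.mul_right A)
      (norm_superposition_term_le hA c ξ)
  simp only [Pi.sub_apply, superposition]
  rw [← (hs _).tsum_sub (hs _), tsum_eq_single i]
  · simp
  · intro j hj
    simp [Function.update_of_ne hj]

/-- For fixed `f` the operators converge pointwise in `x` by dominated convergence as `c` converges.
Fatou's lemma then passes the bound to the limit, also when `q < 1`. -/
lemma isClosed_setOf_superposition_bound {m : ℕ → EuclideanSpace ℝ (Fin n) → ℂ} {A : ℝ}
    (hA : ∀ i ξ, ‖m i ξ‖ ≤ A) (hc : ∀ c, Continuous (superposition m c))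
    (f : Fin n → 𝓢(ℝ, ℂ)) (q B : ℝ≥0∞) :
    IsClosed {c : ℕ → Bool | eLpNorm (multiplierOperator (superposition m c) f) q volume ≤ B} := by
  rw [← isSeqClosed_iff_isClosed]
  intro c c₀ hcB hlim
  refine (Lp.eLpNorm_lim_le_liminf_eLpNorm (p := q)
    (f := fun k => multiplierOperator (superposition m (c k)) f)
    (fun k => (continuous_multiplierOperator (hc _)
      (norm_superposition_le hA _) f).aestronglyMeasurable) _
    (Filter.Eventually.of_forall fun x => tendsto_multiplierOperator (fun k => hc _)
      (fun k => norm_superposition_le hA _) (fun ξ =>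
        ((continuous_superposition_apply hA ξ).tendsto c₀).comp hlim) f x)).trans ?_
  exact Filter.liminf_le_of_le (by isBoundedDefault) fun b hb => by
    obtain ⟨k, hk⟩ := hb.exists
    exact hk.trans (hcB k)

/-- If all superpositions of a sequence of symbols map into `L^q`, then the symbols satisfy
estimates whose constants grow at most like `2 ^ i`. -/
theorem exists_bound_of_mapsLebesgue_superposition {m : ℕ → EuclideanSpace ℝ (Fin n) → ℂ}
    {w : EuclideanSpace ℝ (Fin n) → ℝ} (hm : HasBoundedDerivs w m) (p : Fin n → ℝ≥0∞) (q : ℝ≥0∞)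
    (h : ∀ c, MapsLebesgue (superposition m c) p q) :
    ∃ C : ℝ≥0, ∀ᶠ i in Filter.atTop, ∀ f : Fin n → 𝓢(ℝ, ℂ),
      ENNReal.ofReal ((1 / 2 : ℝ) ^ i) * eLpNorm (multiplierOperator (m i) f) q volume ≤
        C * ∏ j, eLpNorm (f j : ℝ → ℂ) (p j) volume := by
  obtain ⟨A, hA⟩ : ∃ A, ∀ i ξ, ‖m i ξ‖ ≤ A := by simpa using hm.exists_norm_le 0
  have hc : ∀ c, Continuous (superposition m c) := fun c => ((hm.superposition c).1 ()).continuous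
  let S : ℕ → Set (ℕ → Bool) := fun N => {c | ∀ f : Fin n → 𝓢(ℝ, ℂ),
    eLpNorm (multiplierOperator (superposition m c) f) q volume ≤
      (N : ℝ≥0) * ∏ j, eLpNorm (f j : ℝ → ℂ) (p j) volume}
  have hSc : ∀ N, IsClosed (S N) := fun N => by
    simp only [S, Set.ofPred_forall]
    exact isClosed_iInter fun f => isClosed_setOf_superposition_bound hA hc f q _
  have hSU : ⋃ N, S N = Set.univ := by
    refine Set.eq_univ_of_forall fun c => ?_
    obtain ⟨C, hC⟩ := h c
    obtain ⟨N, hN⟩ := exists_nat_ge C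
    refine Set.mem_iUnion.2 ⟨N, fun f => (hC f).trans ?_⟩
    gcongr
  -- Baire category in the compact space `ℕ → Bool`: one constant `N` works on a neighbourhood of
  -- some `c`. In the product topology, changing a sufficiently late coordinate of `c` does not
  -- leave it.
  obtain ⟨N, c, hcN⟩ := nonempty_interior_of_iUnion_of_closed hSc hSU
  have hup : ∀ b : Bool, ∀ᶠ i in Filter.atTop, Function.update c i b ∈ S N := fun b => by
    have : Filter.Tendsto (fun i => Function.update c i b) Filter.atTop (nhds c) := by
      rw [tendsto_pi_nhds]
      intro j
      refine tendsto_const_nhds.congr' ?_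
      filter_upwards [Filter.eventually_gt_atTop j] with i hi
      rw [Function.update_of_ne hi.ne]
    exact this.eventually (mem_interior_iff_mem_nhds.1 hcN)
  -- `LpAddConst q` is the quasi-triangle constant, needed because `q` may be below `1`.
  refine ⟨(ENNReal.LpAddConst q).toNNReal * (N + N), ?_⟩
  filter_upwards [hup true, hup false] with i h1 h0 f
  have hcont : ∀ c, AEStronglyMeasurable (multiplierOperator (superposition m c) f) volume :=
    fun c => (continuous_multiplierOperator (hc c)
      (norm_superposition_le hA c) f).aestronglyMeasurable
  have key : ((1 : ℂ) / 2) ^ i • multiplierOperator (m i) f =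
      multiplierOperator (superposition m (Function.update c i true)) f -
        multiplierOperator (superposition m (Function.update c i false)) f := by
    rw [← multiplierOperator_const_smul, ← superposition_update_sub hA c i,
      multiplierOperator_sub (hc _) (norm_superposition_le hA _) (hc _)
        (norm_superposition_le hA _)]
  calc _ = eLpNorm (((1 : ℂ) / 2) ^ i • multiplierOperator (m i) f) q volume := by
        rw [eLpNorm_const_smul]
        congr 1
        rw [← ofReal_norm]
        simp
    _ ≤ ENNReal.LpAddConst q * (eLpNorm _ q volume + eLpNorm _ q volume) := by
        rw [key]
        exact eLpNorm_sub_le' (hcont _) (hcont _) q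
    _ ≤ ENNReal.LpAddConst q * ((N : ℝ≥0) * ∏ j, eLpNorm (f j : ℝ → ℂ) (p j) volume +
          (N : ℝ≥0) * ∏ j, eLpNorm (f j : ℝ → ℂ) (p j) volume) := by
        gcongr
        · exact h1 f
        · exact h0 f
    _ = _ := by
        rw [ENNReal.coe_mul, ENNReal.coe_toNNReal (ENNReal.LpAddConst_lt_top q).ne, ENNReal.coe_add]
        ring

end

/-! ### Gaussian integrals -/

section

open Complex

/-- Writes a Gaussian of a linear form as a superposition of plane waves, so that only a real
isotropic Gaussian remains to be integrated in `ξ`. -/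
lemma gaussianExp_inv {b : ℂ} (hb : 0 < b.re) (s : ℝ) :
    gaussianExp b⁻¹ s = b ^ (1 / 2 : ℂ) *
      ∫ u : ℝ, gaussianExp b u * cexp (2 * Real.pi * I * (u * s : ℝ)) := by
  have hb0 : b ≠ 0 := by rintro rfl; simp at hb
  have h := congrFun (fourier_gaussian_pi hb) (-s)
  have hpow : b ^ (1 / 2 : ℂ) ≠ 0 := by simp [Complex.cpow_eq_zero_iff, hb0]
  have h2 : ∫ u : ℝ, gaussianExp b u * cexp (2 * Real.pi * I * (u * s : ℝ)) =
      (𝓕 fun x : ℝ => cexp (-Real.pi * b * x ^ 2)) (-s) := by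
    rw [Real.fourier_eq']
    refine integral_congr_ae (Filter.Eventually.of_forall fun u => ?_)
    simp only [gaussianExp, smul_eq_mul]
    rw [mul_comm]
    congr 2
    simp
    ring
  rw [h2, h, gaussianExp]
  field_simp
  congr 1
  push_cast
  ring

lemma integral_gaussianExp {b : ℂ} (hb : 0 < b.re) :
    ∫ u : ℝ, gaussianExp b u = (1 / b) ^ (1 / 2 : ℂ) := by
  have hpi : (Real.pi : ℂ) ≠ 0 := by exact_mod_cast Real.pi_ne_zero
  have h := integral_cexp_quadratic (b := -Real.pi * b)
    (by rw [← ofReal_neg, re_ofReal_mul]; nlinarith [Real.pi_pos]) 0 0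
  simp only [zero_mul, add_zero] at h
  simp only [gaussianExp, h]
  rw [neg_mul, neg_neg, ← div_div, div_self hpi]
  simp

lemma integral_gaussianExp_mul_gaussianExp_add {a b : ℂ} (ha : 0 < a.re) (hb : 0 < b.re) (x : ℝ) :
    ∫ u : ℝ, gaussianExp a u * gaussianExp b (x + u) =
      (1 / (a + b)) ^ (1 / 2 : ℂ) * gaussianExp (a * b / (a + b)) x := by
  have hpi : (Real.pi : ℂ) ≠ 0 := by exact_mod_cast Real.pi_ne_zero
  have hab : 0 < (a + b).re := by rw [add_re]; positivity
  have hab0 : a + b ≠ 0 := by intro h; simp [h] at hab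
  have h := integral_cexp_quadratic (b := -Real.pi * (a + b))
    (by rw [← ofReal_neg, re_ofReal_mul]; nlinarith [Real.pi_pos])
    (-2 * Real.pi * b * x) (-Real.pi * b * x ^ 2)
  have h2 : ∀ u : ℝ, gaussianExp a u * gaussianExp b (x + u) =
      cexp (-Real.pi * (a + b) * u ^ 2 + -2 * Real.pi * b * x * u + -Real.pi * b * x ^ 2) := by
    intro u
    rw [gaussianExp, gaussianExp, ← Complex.exp_add]
    congr 1
    push_cast
    ring
  simp only [h2, h]
  rw [neg_mul, neg_neg, ← div_div, div_self hpi, gaussianExp]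
  congr 2
  field_simp
  ring

lemma integrable_gaussianExp {b : ℂ} (hb : 0 < b.re) : Integrable (gaussianExp b) :=
  (gaussianSchwartz b hb).integrable

/-! ### The chirp symbols -/

variable {n : ℕ}

/-- A chirp in the frequencies `ξ₁, …, ξₙ, ∑ ξᵢ`, localized near the hyperplane orthogonal
to `α`. -/
noncomputable def chirpSymbol (α : EuclideanSpace ℝ (Fin n)) (z : ℂ)
    (ξ : EuclideanSpace ℝ (Fin n)) : ℂ :=
  gaussianExp 1 (inner ℝ α ξ) *
    ((∏ j, gaussianExp ((starRingEnd ℂ) z) (ξ j)) * gaussianExp z (∑ j, ξ j))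

lemma hasBoundedDerivs_chirpSymbol {ι : Type*} (α : EuclideanSpace ℝ (Fin n)) {z : ι → ℂ}
    (hz : ∀ i, 0 < (z i).re) (hz' : ∀ i, ‖z i‖ ^ 2 ≤ (z i).re) :
    HasBoundedDerivs (fun ξ => inner ℝ α ξ) (fun i => chirpSymbol α (z i)) := by
  have h1 := (HasBoundedDerivs.gaussianExp_one (ι := ι)).comp_continuousLinearMap (innerSL ℝ α)
  have h2 := fun j : Fin n => (HasBoundedDerivs.gaussianExp (z := fun i => (starRingEnd ℂ) (z i))
    (by simpa using hz) (by simpa using hz')).comp_continuousLinearMap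
      (EuclideanSpace.proj j : EuclideanSpace ℝ (Fin n) →L[ℝ] ℝ)
  have h3 := (HasBoundedDerivs.gaussianExp hz hz').comp_continuousLinearMap
    (∑ j, (EuclideanSpace.proj j : EuclideanSpace ℝ (Fin n) →L[ℝ] ℝ))
  have h4 := h1.mul ((HasBoundedDerivs.prod Finset.univ fun j _ => h2 j).mul h3)
  simp only [_root_.sum_apply] at h4
  exact h4

lemma prod_gaussianExp (z : ℂ) (ξ : EuclideanSpace ℝ (Fin n)) :
    ∏ j, gaussianExp z (ξ j) = cexp (-Real.pi * z * ‖ξ‖ ^ 2) := by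
  simp only [gaussianExp]
  rw [← Complex.exp_sum, ← Finset.mul_sum, ← ofReal_pow, EuclideanSpace.real_norm_sq_eq]
  push_cast
  rfl

lemma norm_smul_add_smul_sq {α e : EuclideanSpace ℝ (Fin n)} (h : inner ℝ α e = 0) (t y : ℝ) :
    ‖t • α + y • e‖ ^ 2 = t ^ 2 * ‖α‖ ^ 2 + y ^ 2 * ‖e‖ ^ 2 := by
  rw [norm_add_sq_real, real_inner_smul_left, real_inner_smul_right, h, norm_smul, norm_smul,
    mul_pow, mul_pow, Real.norm_eq_abs, Real.norm_eq_abs, sq_abs, sq_abs]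
  ring

lemma integral_gaussian_plane_wave {c : ℝ} (hc : 0 < c) {α e : EuclideanSpace ℝ (Fin n)}
    (h : inner ℝ α e = 0) (t y : ℝ) :
    ∫ ξ : EuclideanSpace ℝ (Fin n), cexp (-Real.pi * c * ‖ξ‖ ^ 2) *
      cexp (2 * Real.pi * I * (t * inner ℝ α ξ + y * inner ℝ e ξ : ℝ)) =
      (1 / c : ℂ) ^ (n / 2 : ℂ) *
        (gaussianExp ((‖α‖ ^ 2 / c : ℝ) : ℂ) t * gaussianExp ((‖e‖ ^ 2 / c : ℝ) : ℂ) y) := by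
  have hpi : (Real.pi : ℂ) ≠ 0 := by exact_mod_cast Real.pi_ne_zero
  have hc0 : (c : ℂ) ≠ 0 := by exact_mod_cast hc.ne'
  have h1 := GaussianFourier.integral_cexp_neg_mul_sq_norm_add (b := Real.pi * c)
    (by rw [← ofReal_mul, ofReal_re]; positivity) (2 * Real.pi * I) (t • α + y • e)
  rw [finrank_euclideanSpace_fin, ← div_div, div_self hpi, ← ofReal_pow,
    norm_smul_add_smul_sq h] at h1
  simp only [← Complex.exp_add, gaussianExp]
  convert h1 using 2
  · funext ξ
    rw [inner_add_left, real_inner_smul_left, real_inner_smul_left]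
    congr 1
    ring
  · congr 1
    push_cast
    field_simp
    rw [I_sq]
    ring

/-- By Fubini the `ξ`-integral becomes the transform of a Gaussian at `t α + (x + u) e`.
Orthogonality of `α` and `e` splits it into a function of `t` and a function of `x + u`, leaving two
one-dimensional Gaussian integrals. -/
lemma integral_gaussian_phase {a v : ℂ} {c : ℝ} (ha : 0 < a.re) (hv : 0 < v.re) (hc : 0 < c)
    {α e : EuclideanSpace ℝ (Fin n)} (he : e ≠ 0) (h : inner ℝ α e = 0) (x : ℝ) :
    ∫ ξ : EuclideanSpace ℝ (Fin n), cexp (-Real.pi * c * ‖ξ‖ ^ 2) *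
      (∫ t : ℝ, gaussianExp a t * cexp (2 * Real.pi * I * (t * inner ℝ α ξ : ℝ))) *
      (∫ u : ℝ, gaussianExp v u * cexp (2 * Real.pi * I * (u * inner ℝ e ξ : ℝ))) *
      cexp (2 * Real.pi * I * (x * inner ℝ e ξ : ℝ)) =
    (1 / c : ℂ) ^ (n / 2 : ℂ) * (1 / (a + (‖α‖ ^ 2 / c : ℝ))) ^ (1 / 2 : ℂ) *
      ((1 / (v + (‖e‖ ^ 2 / c : ℝ))) ^ (1 / 2 : ℂ) *
        gaussianExp (v * (‖e‖ ^ 2 / c : ℝ) / (v + (‖e‖ ^ 2 / c : ℝ))) x) := by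
  have hE : Integrable fun ξ : EuclideanSpace ℝ (Fin n) => cexp (-Real.pi * c * ‖ξ‖ ^ 2) := by
    simpa using GaussianFourier.integrable_cexp_neg_mul_sq_norm_add (b := Real.pi * c)
      (by rw [← ofReal_mul, ofReal_re]; positivity) 0 (0 : EuclideanSpace ℝ (Fin n))
  have hP : Integrable fun p : ℝ × ℝ => gaussianExp a p.1 * gaussianExp v p.2 :=
    (integrable_gaussianExp ha).mul_prod (integrable_gaussianExp hv)
  let K : EuclideanSpace ℝ (Fin n) → ℝ × ℝ → ℂ := fun ξ p =>
    cexp (-Real.pi * c * ‖ξ‖ ^ 2) * (gaussianExp a p.1 * gaussianExp v p.2) *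
      cexp (((2 * Real.pi * (p.1 * inner ℝ α ξ + (x + p.2) * inner ℝ e ξ) : ℝ) : ℂ) * I)
  have hK : Integrable (Function.uncurry K) (volume.prod volume) := by
    refine (hE.mul_prod hP).mul_bdd (c := 1) (Continuous.aestronglyMeasurable ?_)
      (Filter.Eventually.of_forall fun q => (norm_exp_ofReal_mul_I _).le)
    fun_prop
  have h1 : ∀ ξ : EuclideanSpace ℝ (Fin n), cexp (-Real.pi * c * ‖ξ‖ ^ 2) *
      (∫ t : ℝ, gaussianExp a t * cexp (2 * Real.pi * I * (t * inner ℝ α ξ : ℝ))) *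
      (∫ u : ℝ, gaussianExp v u * cexp (2 * Real.pi * I * (u * inner ℝ e ξ : ℝ))) *
      cexp (2 * Real.pi * I * (x * inner ℝ e ξ : ℝ)) = ∫ p, K ξ p := by
    intro ξ
    rw [mul_assoc (cexp _) (∫ t : ℝ, _), ← integral_prod_mul, ← Measure.volume_eq_prod,
      ← integral_const_mul, ← integral_mul_const]
    refine integral_congr_ae (Filter.Eventually.of_forall fun p => ?_)
    simp only [K]
    have : cexp (((2 * Real.pi * (p.1 * inner ℝ α ξ + (x + p.2) * inner ℝ e ξ) : ℝ) : ℂ) * I) =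
        cexp (2 * Real.pi * I * (p.1 * inner ℝ α ξ : ℝ)) *
        cexp (2 * Real.pi * I * (p.2 * inner ℝ e ξ : ℝ)) *
        cexp (2 * Real.pi * I * (x * inner ℝ e ξ : ℝ)) := by
      rw [← Complex.exp_add, ← Complex.exp_add]
      congr 1
      push_cast
      ring
    rw [this]
    ring
  have h2 : ∀ p : ℝ × ℝ, ∫ ξ, K ξ p = (1 / c : ℂ) ^ (n / 2 : ℂ) *
      (gaussianExp (a + (‖α‖ ^ 2 / c : ℝ)) p.1 *
        (gaussianExp v p.2 * gaussianExp ((‖e‖ ^ 2 / c : ℝ) : ℂ) (x + p.2))) := by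
    intro p
    have h3 : gaussianExp (a + (‖α‖ ^ 2 / c : ℝ)) p.1 =
        gaussianExp a p.1 * gaussianExp ((‖α‖ ^ 2 / c : ℝ) : ℂ) p.1 := by
      rw [gaussianExp, gaussianExp, gaussianExp, ← Complex.exp_add]
      congr 1
      ring
    have h4 := integral_gaussian_plane_wave hc h p.1 (x + p.2)
    calc ∫ ξ, K ξ p = ∫ ξ : EuclideanSpace ℝ (Fin n), (gaussianExp a p.1 * gaussianExp v p.2) *
          (cexp (-Real.pi * c * ‖ξ‖ ^ 2) * cexp (2 * Real.pi * I *
            (p.1 * inner ℝ α ξ + (x + p.2) * inner ℝ e ξ : ℝ))) := by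
          refine integral_congr_ae (Filter.Eventually.of_forall fun ξ => ?_)
          simp only [K]
          rw [show ((2 * Real.pi * (p.1 * inner ℝ α ξ + (x + p.2) * inner ℝ e ξ) : ℝ) : ℂ) * I =
            2 * Real.pi * I * (p.1 * inner ℝ α ξ + (x + p.2) * inner ℝ e ξ : ℝ) by
              push_cast; ring]
          ring
      _ = _ := by
          rw [integral_const_mul, h4, h3]
          ring
  have he' : 0 < ‖e‖ := norm_pos_iff.2 he
  simp_rw [h1]
  rw [integral_integral_swap hK]
  simp_rw [h2]
  rw [integral_const_mul, Measure.volume_eq_prod, integral_prod_mul (gaussianExp (a + (‖α‖ ^ 2 / c : ℝ)))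
      (fun u => gaussianExp v u * gaussianExp ((‖e‖ ^ 2 / c : ℝ) : ℂ) (x + u)),
    integral_gaussianExp_mul_gaussianExp_add hv (by rw [ofReal_re]; positivity),
    integral_gaussianExp (by rw [add_re, ofReal_re]; positivity), mul_assoc]

/-- The transform of the input is `v^(-1/2) exp(-π v⁻¹ y²)`, and its product with the conjugate
chirp of the symbol is `exp(-π c y²)` up to that constant, with `c = 2 Re v⁻¹`. The oscillation in
each `ξ_j` cancels. The sum `∑ ξ_j` is the inner product with `e = (1, …, 1)`, and `hα` says that `α
⟂ e`. -/
lemma multiplierOperator_chirpSymbol {α : EuclideanSpace ℝ (Fin n)} (hα : ∑ j, α j = 0)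
    (hn : 0 < n) {v : ℂ} (hv : 0 < v.re) (x : ℝ) :
    multiplierOperator (chirpSymbol α v⁻¹) (fun _ => gaussianSchwartz v hv) x =
      (1 / v ^ (1 / 2 : ℂ)) ^ n * v ^ (1 / 2 : ℂ) *
      ((1 / (2 * v⁻¹.re : ℝ) : ℂ) ^ (n / 2 : ℂ) *
        (1 / (1 + (‖α‖ ^ 2 / (2 * v⁻¹.re) : ℝ))) ^ (1 / 2 : ℂ) *
      ((1 / (v + (n / (2 * v⁻¹.re) : ℝ))) ^ (1 / 2 : ℂ) *
        gaussianExp (v * (n / (2 * v⁻¹.re) : ℝ) / (v + (n / (2 * v⁻¹.re) : ℝ))) x)) := by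
  have hc : 0 < 2 * v⁻¹.re := by
    have hv0 : v ≠ 0 := by rintro rfl; simp at hv
    rw [inv_re]
    have := normSq_pos.2 hv0
    positivity
  let e : EuclideanSpace ℝ (Fin n) := WithLp.toLp 2 fun _ => 1
  have he : ∀ ξ : EuclideanSpace ℝ (Fin n), inner ℝ e ξ = ∑ j, ξ j := fun ξ => by
    simp [e, PiLp.inner_apply]
  have hnorm : ‖e‖ ^ 2 = n := by rw [EuclideanSpace.real_norm_sq_eq]; simp [e]
  have he0 : e ≠ 0 := by
    intro h
    rw [h] at hnorm
    have : (n : ℝ) = 0 := by simpa using hnorm.symm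
    exact hn.ne' (by exact_mod_cast this)
  have hαe : inner ℝ α e = 0 := by rw [real_inner_comm, he, hα]
  have key := integral_gaussian_phase (a := 1) (v := v) (by simp) hv hc he0 hαe x
  rw [hnorm] at key
  rw [← key, multiplierOperator, ← integral_const_mul]
  refine integral_congr_ae (Filter.Eventually.of_forall fun ξ => ?_)
  have hF : ∀ y : ℝ, 𝓕 (gaussianSchwartz v hv : ℝ → ℂ) y =
      1 / v ^ (1 / 2 : ℂ) * gaussianExp v⁻¹ y := fun y => by
    rw [coe_gaussianSchwartz]
    have := congrFun (fourier_gaussian_pi hv) y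
    rw [gaussianExp, ← div_eq_mul_inv]
    exact this
  have h1 := gaussianExp_inv (b := 1) (by simp) (inner ℝ α ξ)
  rw [inv_one, one_cpow, one_mul] at h1
  have h2 := gaussianExp_inv hv (∑ j, ξ j)
  simp only [chirpSymbol, hF, he, Finset.prod_mul_distrib, Finset.prod_const, Finset.card_univ,
    Fintype.card_fin]
  rw [← h1, h2, prod_gaussianExp, prod_gaussianExp]
  have h3 : cexp (-Real.pi * (2 * v⁻¹.re : ℝ) * ‖ξ‖ ^ 2) =
      cexp (-Real.pi * (starRingEnd ℂ) v⁻¹ * ‖ξ‖ ^ 2) * cexp (-Real.pi * v⁻¹ * ‖ξ‖ ^ 2) := by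
    rw [← Complex.exp_add, ← add_conj]
    congr 1
    ring
  rw [h3]
  have h4 : cexp (2 * Real.pi * I * x * ((∑ j, ξ j : ℝ) : ℂ)) =
      cexp (2 * Real.pi * I * (x * ∑ j, ξ j : ℝ)) := by
    congr 1
    push_cast
    ring
  rw [h4]
  ring

end

/-! ### The lower bound -/

section

variable {n : ℕ}

lemma norm_cpow_half (z : ℂ) : ‖z ^ (1 / 2 : ℂ)‖ = ‖z‖ ^ (1 / 2 : ℝ) := by
  rw [← Complex.norm_cpow_real]
  push_cast
  rfl

/-- Keeps the output from concentrating as `‖v‖` grows: `Re (v b / (v + b)) = b (‖v‖² + b) / ‖v +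
b‖²` stays below `2`. In the application `b = n ‖v‖² / 2`, so `hb` amounts to `n ≥ 4`. -/
lemma norm_gaussianExp_two_le {v : ℂ} (hv : v.re = 1) {b : ℝ} (hb : 2 * ‖v‖ ^ 2 ≤ b) (x : ℝ) :
    ‖gaussianExp 2 x‖ ≤ ‖gaussianExp (v * b / (v + b)) x‖ := by
  have hr1 : 1 ≤ ‖v‖ := hv ▸ Complex.re_le_norm v
  have hb0 : 0 < b := by nlinarith
  have hsq : ‖v‖ ^ 2 = 1 + v.im ^ 2 := by
    rw [← Complex.normSq_eq_norm_sq, Complex.normSq_apply, hv]; ring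
  rw [hsq] at hb
  have hre : (v * b / (v + b)).re ≤ 2 := by
    have hN : Complex.normSq (v + b) = (1 + b) ^ 2 + v.im ^ 2 := by
      rw [Complex.normSq_apply]; simp [hv]; ring
    have hpos : 0 < (1 + b) ^ 2 + v.im ^ 2 := by positivity
    rw [Complex.div_re, hN, ← add_div, div_le_iff₀ hpos]
    simp [hv]
    nlinarith [mul_le_mul_of_nonneg_left hb hb0.le, sq_nonneg v.im]
  rw [norm_gaussianExp, norm_gaussianExp, Real.exp_le_exp]
  have h2 : (2 : ℂ).re = 2 := rfl
  rw [h2]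
  have := mul_nonneg Real.pi_pos.le (sq_nonneg x)
  nlinarith

lemma exists_le_norm_multiplierOperator_chirpSymbol {α : EuclideanSpace ℝ (Fin n)}
    (hα : ∑ j, α j = 0) (hn : 4 ≤ n) : ∃ κ : ℝ, 0 < κ ∧ ∀ (v : ℂ) (hv : 0 < v.re), v.re = 1 →
      ∀ x, κ * ‖v‖ ^ (1 / 2 : ℝ) * ‖gaussianExp 2 x‖ ≤
        ‖multiplierOperator (chirpSymbol α v⁻¹) (fun _ => gaussianSchwartz v hv) x‖ := by
  have hn0 : (0 : ℝ) < n := by exact_mod_cast (by omega : 0 < n)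
  refine ⟨(1 / 2) ^ (n / 2 : ℝ) * (1 / (1 + ‖α‖ ^ 2)) ^ (1 / 2 : ℝ) *
    (1 / (1 + n)) ^ (1 / 2 : ℝ), by positivity, fun v hv hv1 x => ?_⟩
  have hv0 : v ≠ 0 := by rintro rfl; simp at hv
  have hr1 : 1 ≤ ‖v‖ := hv1 ▸ Complex.re_le_norm v
  have hr : 0 < ‖v‖ := one_pos.trans_le hr1
  have hc : 2 * v⁻¹.re = 2 / ‖v‖ ^ 2 := by
    rw [Complex.inv_re, hv1, Complex.normSq_eq_norm_sq]; ring
  have e1 : ‖(1 / v ^ (1 / 2 : ℂ)) ^ n‖ = ‖v‖ ^ (-(n / 2 : ℝ)) := by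
    rw [norm_pow, norm_div, norm_one, norm_cpow_half, one_div, ← Real.rpow_neg hr.le,
      ← Real.rpow_mul_natCast hr.le]
    congr 1
    ring
  have e2 : ‖(1 / (2 / ‖v‖ ^ 2 : ℝ) : ℂ) ^ (n / 2 : ℂ)‖ =
      (1 / 2) ^ (n / 2 : ℝ) * ‖v‖ ^ (n : ℝ) := by
    rw [show (n / 2 : ℂ) = ((n / 2 : ℝ) : ℂ) by push_cast; rfl, Complex.norm_cpow_real, norm_div,
      norm_one, Complex.norm_real, Real.norm_of_nonneg (by positivity), one_div_div,
      show ‖v‖ ^ 2 / 2 = 1 / 2 * ‖v‖ ^ (2 : ℝ) by rw [Real.rpow_two]; ring,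
      Real.mul_rpow (by norm_num) (by positivity), ← Real.rpow_mul hr.le]
    congr 2
    ring
  -- Each of the integrals over `t` and `u` costs one factor `‖v‖⁻¹`.
  have half : ∀ {w : ℂ} {B : ℝ}, 0 < B → 0 < w.re → ‖w‖ ≤ B * ‖v‖ ^ 2 →
      (1 / B) ^ (1 / 2 : ℝ) * ‖v‖ ^ (-1 : ℝ) ≤ ‖(1 / w) ^ (1 / 2 : ℂ)‖ := by
    intro w B hB hw hwB
    have hw0 : w ≠ 0 := by rintro rfl; simp at hw
    have hw1 : 0 < ‖w‖ := norm_pos_iff.2 hw0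
    rw [norm_cpow_half, norm_div, norm_one]
    calc _ = (1 / (B * ‖v‖ ^ 2)) ^ (1 / 2 : ℝ) := by
          rw [show 1 / (B * ‖v‖ ^ 2) = 1 / B * ‖v‖ ^ (-2 : ℝ) by
            rw [Real.rpow_neg hr.le, Real.rpow_two]; field_simp,
            Real.mul_rpow (by positivity) (by positivity), ← Real.rpow_mul hr.le]
          norm_num
      _ ≤ _ := by gcongr
  have hsq : 1 ≤ ‖v‖ ^ 2 := one_le_pow₀ hr1
  have e3 := half (w := 1 + (‖α‖ ^ 2 / (2 / ‖v‖ ^ 2) : ℝ)) (B := 1 + ‖α‖ ^ 2) (by positivity)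
    (by rw [Complex.add_re, Complex.ofReal_re, Complex.one_re]; positivity) (by
      rw [← Complex.ofReal_one, ← Complex.ofReal_add, Complex.norm_real,
        Real.norm_of_nonneg (by positivity), div_div_eq_mul_div]
      nlinarith [mul_nonneg (sq_nonneg ‖α‖) (sq_nonneg ‖v‖)])
  have e4 := half (w := v + (n / (2 / ‖v‖ ^ 2) : ℝ)) (B := 1 + n) (by positivity)
    (by rw [Complex.add_re, Complex.ofReal_re, hv1]; positivity) (by
      refine (norm_add_le _ _).trans ?_
      rw [Complex.norm_real, Real.norm_of_nonneg (by positivity), div_div_eq_mul_div]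
      nlinarith [mul_nonneg hn0.le (sq_nonneg ‖v‖)])
  have e5 := norm_gaussianExp_two_le hv1 (b := n / (2 / ‖v‖ ^ 2)) (by
    rw [div_div_eq_mul_div]
    have : (4 : ℝ) ≤ n := by exact_mod_cast hn
    nlinarith [mul_le_mul_of_nonneg_right this (sq_nonneg ‖v‖)]) x
  -- The total exponent is `(n - 3) / 2`, which is at least `1 / 2` exactly when `n ≥ 4`.
  have e6 : ‖v‖ ^ (1 / 2 : ℝ) ≤ ‖v‖ ^ (-(n / 2 : ℝ)) * ‖v‖ ^ (1 / 2 : ℝ) * ‖v‖ ^ (n : ℝ) *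
      ‖v‖ ^ (-1 : ℝ) * ‖v‖ ^ (-1 : ℝ) := by
    rw [← Real.rpow_add hr, ← Real.rpow_add hr, ← Real.rpow_add hr, ← Real.rpow_add hr]
    refine Real.rpow_le_rpow_of_exponent_le hr1 ?_
    have : (4 : ℝ) ≤ n := by exact_mod_cast hn
    linarith
  rw [multiplierOperator_chirpSymbol hα (by omega) hv, hc]
  simp only [norm_mul] at e5 ⊢
  rw [e1, e2, norm_cpow_half]
  calc _ ≤ (1 / 2) ^ (n / 2 : ℝ) * (1 / (1 + ‖α‖ ^ 2)) ^ (1 / 2 : ℝ) *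
        (1 / (1 + n)) ^ (1 / 2 : ℝ) * (‖v‖ ^ (-(n / 2 : ℝ)) * ‖v‖ ^ (1 / 2 : ℝ) * ‖v‖ ^ (n : ℝ) *
      ‖v‖ ^ (-1 : ℝ) * ‖v‖ ^ (-1 : ℝ)) * ‖gaussianExp 2 x‖ := by gcongr
    _ = ‖v‖ ^ (-(n / 2 : ℝ)) * ‖v‖ ^ (1 / 2 : ℝ) * ((1 / 2) ^ (n / 2 : ℝ) * ‖v‖ ^ (n : ℝ) *
        ((1 / (1 + ‖α‖ ^ 2)) ^ (1 / 2 : ℝ) * ‖v‖ ^ (-1 : ℝ)) *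
        ((1 / (1 + n)) ^ (1 / 2 : ℝ) * ‖v‖ ^ (-1 : ℝ) * ‖gaussianExp 2 x‖)) := by ring
    _ ≤ _ := by gcongr

end

/-! ### A non-degenerate hyperplane -/

section

variable {n : ℕ}

/-- A vector with distinct nonzero entries that sum to zero. -/
noncomputable def transversalVector (n : ℕ) : EuclideanSpace ℝ (Fin n) :=
  WithLp.toLp 2 fun j => n * 2 ^ (j : ℕ) - (2 ^ n - 1)

lemma sum_transversalVector (n : ℕ) : ∑ j, transversalVector n j = 0 := by
  simp only [transversalVector]
  rw [Finset.sum_sub_distrib, ← Finset.mul_sum, Fin.sum_univ_eq_sum_range (fun j => (2 : ℝ) ^ j),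
    geom_sum_eq (by norm_num)]
  simp
  ring

lemma transversalVector_injective (hn : 0 < n) :
    Function.Injective fun j => transversalVector n j := by
  intro i j h
  have hn0 : (n : ℝ) ≠ 0 := by exact_mod_cast hn.ne'
  have h1 : (2 : ℝ) ^ (i : ℕ) = 2 ^ (j : ℕ) := by
    simpa [transversalVector, hn0] using h
  exact Fin.ext (pow_right_injective₀ (by norm_num) (by norm_num) h1)

/-- A zero entry means `n 2^j + 1 = 2^n`. This fails by size for `j = 0` and by parity for `j > 0`.
-/
lemma transversalVector_ne_zero (hn : 2 ≤ n) (j : Fin n) : transversalVector n j ≠ 0 := by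
  intro h
  have h1 : n * 2 ^ (j : ℕ) + 1 = 2 ^ n := by
    have : ((n * 2 ^ (j : ℕ) + 1 : ℕ) : ℝ) = ((2 ^ n : ℕ) : ℝ) := by
      simp only [transversalVector] at h
      push_cast
      linarith
    exact_mod_cast this
  rcases Nat.eq_zero_or_pos (j : ℕ) with h0 | h0
  · rw [h0] at h1
    obtain ⟨k, rfl⟩ := Nat.exists_eq_add_of_le hn
    have := Nat.lt_two_pow_self (n := k)
    rw [pow_add] at h1
    omega
  · have h2 : Even (n * 2 ^ (j : ℕ)) := (even_two.pow_of_ne_zero h0.ne' : Even (2 ^ (j : ℕ))).mul_left n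
    have h3 : Even (2 ^ n) := even_two.pow_of_ne_zero (by omega)
    rw [← h1] at h3
    exact (Nat.not_even_iff_odd.2 h2.add_one) h3

lemma formFrequencies_castSucc (ξ : EuclideanSpace ℝ (Fin n)) (i : Fin n) :
    formFrequencies ξ i.castSucc = ξ i := Fin.snoc_castSucc (α := fun _ => ℝ) _ _ _

lemma formFrequencies_last (ξ : EuclideanSpace ℝ (Fin n)) :
    formFrequencies ξ (Fin.last n) = -∑ i, ξ i := Fin.snoc_last (α := fun _ => ℝ) _ _

lemma formFrequencies_add (ξ η : EuclideanSpace ℝ (Fin n)) (i : Fin (n + 1)) :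
    formFrequencies (ξ + η) i = formFrequencies ξ i + formFrequencies η i := by
  refine Fin.lastCases ?_ (fun j => ?_) i
  · simp [formFrequencies_last, Finset.sum_add_distrib, add_comm]
  · simp [formFrequencies_castSucc]

lemma formFrequencies_smul (c : ℝ) (ξ : EuclideanSpace ℝ (Fin n)) (i : Fin (n + 1)) :
    formFrequencies (c • ξ) i = c * formFrequencies ξ i := by
  refine Fin.lastCases ?_ (fun j => ?_) i
  · simp [formFrequencies_last, Finset.mul_sum]
  · simp [formFrequencies_castSucc]

lemma sum_formFrequencies (ξ : EuclideanSpace ℝ (Fin n)) : ∑ i, formFrequencies ξ i = 0 := by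
  rw [Fin.sum_univ_castSucc, formFrequencies_last]
  simp [formFrequencies_castSucc]

/-- The frequencies satisfy two linear relations, with coefficients `1` and `β = (α, 0)`. Only two
frequencies can be nonzero, and the entries of `β` are distinct, so the remaining `2 × 2` system is
invertible. -/
lemma eq_zero_of_formFrequencies {α ξ : EuclideanSpace ℝ (Fin n)}
    (hinj : Function.Injective fun j => α j) (hne : ∀ j, α j ≠ 0) (h : inner ℝ α ξ = 0)
    {s : Finset (Fin (n + 1))} (hs : s.card = n - 1) (hn : 1 ≤ n)
    (hξ : ∀ i ∈ s, formFrequencies ξ i = 0) : ξ = 0 := by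
  classical
  let β : Fin (n + 1) → ℝ := Fin.snoc (fun j => α j) 0
  have hβc : ∀ j : Fin n, β j.castSucc = α j := fun j => Fin.snoc_castSucc (α := fun _ => ℝ) _ _ _
  have hβl : β (Fin.last n) = 0 := Fin.snoc_last (α := fun _ => ℝ) _ _
  have hβ : Function.Injective β := by
    intro i j
    refine Fin.lastCases (fun hij => ?_) (fun i hij => ?_) i <;>
    refine Fin.lastCases (fun hij => ?_) (fun j hij => ?_) j hij
    · rfl
    · rw [hβl, hβc] at hij; exact absurd hij.symm (hne j)
    · rw [hβl, hβc] at hij; exact absurd hij (hne i)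
    · rw [hβc, hβc] at hij; exact congrArg _ (hinj hij)
  have h1 : ∑ i, β i * formFrequencies ξ i = 0 := by
    rw [Fin.sum_univ_castSucc, hβl]
    simp only [hβc, formFrequencies_castSucc, zero_mul, add_zero]
    rw [← h, PiLp.inner_apply]
    simp [mul_comm]
  have hcard : sᶜ.card = 2 := by
    rw [Finset.card_compl, hs, Fintype.card_fin]; omega
  obtain ⟨a, b, hab, hsab⟩ := Finset.card_eq_two.1 hcard
  have hsum : ∀ g : Fin (n + 1) → ℝ, ∑ i, g i * formFrequencies ξ i =
      g a * formFrequencies ξ a + g b * formFrequencies ξ b := by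
    intro g
    rw [← Finset.sum_pair hab (f := fun i => g i * formFrequencies ξ i), ← hsab]
    refine (Finset.sum_subset (Finset.subset_univ _) fun i _ hi => ?_).symm
    rw [hξ i (by simpa using hi), mul_zero]
  have e1 := hsum β
  have e2 := hsum 1
  simp only [Pi.one_apply, one_mul] at e2
  rw [sum_formFrequencies] at e2
  rw [h1] at e1
  have hne' : β a - β b ≠ 0 := sub_ne_zero.2 fun h => hab (hβ h)
  have ha : formFrequencies ξ a = 0 := by
    have : (β a - β b) * formFrequencies ξ a = 0 := by linear_combination -e1 + β b * e2
    exact (mul_eq_zero.1 this).resolve_left hne'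
  have hb : formFrequencies ξ b = 0 := by linarith
  ext j
  rw [PiLp.zero_apply, ← formFrequencies_castSucc]
  by_cases hj : j.castSucc ∈ s
  · exact hξ _ hj
  · have : j.castSucc ∈ sᶜ := by simpa using hj
    rw [hsab] at this
    rcases Finset.mem_insert.1 this with h | h
    · rw [h, ha]
    · rw [Finset.mem_singleton.1 h, hb]

lemma finrank_orthogonal_singleton {α : EuclideanSpace ℝ (Fin n)} (hα : α ≠ 0) :
    Module.finrank ℝ (ℝ ∙ α)ᗮ = n - 1 := by
  have h := (ℝ ∙ α).finrank_add_finrank_orthogonal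
  rw [finrank_span_singleton hα, finrank_euclideanSpace_fin] at h
  omega

lemma isNonDegenerate_orthogonal_singleton {α : EuclideanSpace ℝ (Fin n)} (hn : 1 ≤ n)
    (hinj : Function.Injective fun j => α j) (hne : ∀ j, α j ≠ 0) :
    IsNonDegenerate (ℝ ∙ α)ᗮ := by
  have hα : α ≠ 0 := by
    rintro rfl
    exact hne ⟨0, hn⟩ rfl
  intro s hs
  let φ : EuclideanSpace ℝ (Fin n) →ₗ[ℝ] (s → ℝ) :=
    { toFun := fun ξ i => formFrequencies ξ i
      map_add' := fun ξ η => funext fun i => formFrequencies_add ξ η i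
      map_smul' := fun c ξ => funext fun i => formFrequencies_smul c ξ i }
  let ψ := φ.domRestrict (ℝ ∙ α)ᗮ
  have hinjψ : Function.Injective ψ := by
    rw [← LinearMap.ker_eq_bot, LinearMap.ker_eq_bot']
    intro ξ hξ
    refine Subtype.ext (eq_zero_of_formFrequencies hinj hne
      (Submodule.mem_orthogonal_singleton_iff_inner_right.1 ξ.2)
      (hs.trans (finrank_orthogonal_singleton hα)) hn fun i hi => congrFun hξ ⟨i, hi⟩)
  refine ⟨hinjψ, (LinearMap.injective_iff_surjective_of_finrank_eq_finrank ?_).1 hinjψ⟩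
  rw [Module.finrank_fintype_fun_eq_card, Fintype.card_coe, hs]

lemma infDist_orthogonal_singleton_le {α : EuclideanSpace ℝ (Fin n)} (hα : 1 ≤ ‖α‖)
    (ξ : EuclideanSpace ℝ (Fin n)) :
    Metric.infDist ξ ((ℝ ∙ α)ᗮ : Set (EuclideanSpace ℝ (Fin n))) ≤ |inner ℝ α ξ| := by
  have hpos : 0 < ‖α‖ := one_pos.trans_le hα
  have hmem : ξ - (inner ℝ α ξ / ‖α‖ ^ 2) • α ∈ (ℝ ∙ α)ᗮ := by
    rw [Submodule.mem_orthogonal_singleton_iff_inner_right, inner_sub_right,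
      real_inner_smul_right, real_inner_self_eq_norm_sq]
    field_simp
    ring
  refine (Metric.infDist_le_dist_of_mem hmem).trans ?_
  rw [dist_eq_norm, sub_sub_cancel, norm_smul, Real.norm_eq_abs, abs_div,
    abs_of_pos (by positivity : 0 < ‖α‖ ^ 2)]
  rw [div_mul_eq_mul_div, div_le_iff₀ (by positivity)]
  gcongr
  nlinarith

lemma one_le_norm_transversalVector (hn : 2 ≤ n) : 1 ≤ ‖transversalVector n‖ := by
  have h := PiLp.norm_apply_le (transversalVector n) ⟨0, by omega⟩
  refine le_trans ?_ h
  have h1 := transversalVector_ne_zero hn ⟨0, by omega⟩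
  have h2 : transversalVector n ⟨0, by omega⟩ = ((n - (2 ^ n - 1) : ℤ) : ℝ) := by
    simp [transversalVector]
  rw [h2] at h1 ⊢
  rw [Real.norm_eq_abs]
  have h3 : (n - (2 ^ n - 1) : ℤ) ≠ 0 := fun h0 => h1 (by rw [h0, Int.cast_zero])
  exact_mod_cast Int.one_le_abs h3

end

theorem mainTheorem3 (n : ℕ) (hn : 4 ≤ n) (p : Fin n → ℝ≥0∞) (q : ℝ≥0∞)
    (hp : ∀ i, 1 < p i) (hq : 0 < q) (hq' : q ≠ ⊤) (hpq : ∑ i, (p i)⁻¹ = q⁻¹) :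
    ∃ (Γ : Submodule ℝ (EuclideanSpace ℝ (Fin n))) (m : EuclideanSpace ℝ (Fin n) → ℂ),
      Module.finrank ℝ Γ = n - 1 ∧ IsNonDegenerate Γ ∧ IsMikhlinSymbol Γ m ∧
        ¬ MapsLebesgue m p q := by
  set α := transversalVector n with hα
  have hα1 : 1 ≤ ‖α‖ := one_le_norm_transversalVector (by omega)
  have hα0 : α ≠ 0 := norm_pos_iff.1 (one_pos.trans_le hα1)
  -- The gain `‖v i‖^(1/2) ≥ 4^i` has to beat the loss `2^i` of the Baire argument.
  let v : ℕ → ℂ := fun i => 1 + 16 ^ i * Complex.I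
  have hvre : ∀ i, (v i).re = 1 := fun i => by
    simp only [v]
    rw [show (16 : ℂ) ^ i = ((16 ^ i : ℝ) : ℂ) by push_cast; rfl, Complex.add_re,
      Complex.re_ofReal_mul]
    simp
  have hvpos : ∀ i, 0 < (v i).re := fun i => by rw [hvre]; exact one_pos
  have hvnorm : ∀ i, (16 : ℝ) ^ i ≤ ‖v i‖ := fun i => by
    refine le_trans (le_of_eq ?_) ((le_abs_self _).trans (Complex.abs_im_le_norm (v i)))
    simp only [v]
    rw [show (16 : ℂ) ^ i = ((16 ^ i : ℝ) : ℂ) by push_cast; rfl, Complex.add_im,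
      Complex.im_ofReal_mul]
    simp
  have hzre : ∀ i, (v i)⁻¹.re = ‖(v i)⁻¹‖ ^ 2 := fun i => by
    rw [Complex.inv_re, hvre, Complex.normSq_eq_norm_sq, norm_inv, inv_pow, one_div]
  have hm : HasBoundedDerivs (fun ξ => inner ℝ α ξ) (fun i => chirpSymbol α (v i)⁻¹) :=
    hasBoundedDerivs_chirpSymbol α (fun i => by
      rw [hzre]
      have : v i ≠ 0 := by intro h; have := hvpos i; simp [h] at this
      exact pow_pos (norm_pos_iff.2 (inv_ne_zero this)) 2) fun i => (hzre i).ge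
  by_contra hcon
  push Not at hcon
  -- Every superposition is an admissible symbol for the same `Γ`, so denying the theorem bounds all
  -- of them at once. The unbounded symbol is not identified.
  have hbdd : ∀ c, MapsLebesgue (superposition (fun i => chirpSymbol α (v i)⁻¹) c) p q := fun c =>
    hcon (ℝ ∙ α)ᗮ _ (finrank_orthogonal_singleton hα0)
      (isNonDegenerate_orthogonal_singleton (by omega) (transversalVector_injective (by omega))
        (transversalVector_ne_zero (by omega)))
      ((hm.superposition c).isMikhlinSymbol () (infDist_orthogonal_singleton_le hα1))
  obtain ⟨C, hC⟩ := exists_bound_of_mapsLebesgue_superposition hm p q hbdd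
  obtain ⟨κ, hκ, hlow⟩ :=
    exists_le_norm_multiplierOperator_chirpSymbol (sum_transversalVector n) hn
  have hfin : C * ∏ j, eLpNorm (gaussianExp 1) (p j) volume < ⊤ :=
    ENNReal.mul_lt_top ENNReal.coe_lt_top (ENNReal.prod_lt_top fun j _ =>
      ((gaussianSchwartz 1 (by simp)).memLp (p j) volume).2)
  have hnorm : ∀ i j, eLpNorm (gaussianSchwartz (v i) (hvpos i) : ℝ → ℂ) (p j) volume =
      eLpNorm (gaussianExp 1) (p j) volume := fun i j => by
    refine eLpNorm_congr_norm_ae (Filter.Eventually.of_forall fun x => ?_)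
    rw [coe_gaussianSchwartz, norm_gaussianExp, norm_gaussianExp, hvre, Complex.one_re]
  have hpos : eLpNorm (gaussianExp 2) q volume ≠ 0 := by
    rw [Ne, eLpNorm_eq_zero_iff (contDiff_gaussianExp 2).continuous.aestronglyMeasurable hq.ne']
    intro h
    have := (Continuous.ae_eq_iff_eq volume (contDiff_gaussianExp 2).continuous
      continuous_zero).1 h
    simpa [gaussianExp] using congrFun this 0
  -- The right side is finite and independent of `i`, while on the left `2⁻ⁱ · 4^i = 2^i` tends to
  -- infinity.
  have hgrow : ∀ᶠ i in Filter.atTop, ENNReal.ofReal (2 ^ i * κ) * eLpNorm (gaussianExp 2) q volume ≤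
      C * ∏ j, eLpNorm (gaussianExp 1) (p j) volume := by
    filter_upwards [hC] with i hi
    have h1 := hi fun _ => gaussianSchwartz (v i) (hvpos i)
    simp only [hnorm] at h1
    refine le_trans ?_ h1
    have h2 : ENNReal.ofReal (κ * 4 ^ i) * eLpNorm (gaussianExp 2) q volume ≤ eLpNorm
        (multiplierOperator (chirpSymbol α (v i)⁻¹) fun _ => gaussianSchwartz (v i) (hvpos i))
        q volume := by
      calc _ = eLpNorm (((κ * 4 ^ i : ℝ) : ℂ) • gaussianExp 2) q volume := by
            rw [eLpNorm_const_smul, ← ofReal_norm, Complex.norm_real, Real.norm_of_nonneg]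
            positivity
        _ ≤ _ := by
            refine eLpNorm_mono fun x => le_trans ?_ (hlow (v i) (hvpos i) (hvre i) x)
            rw [Pi.smul_apply, norm_smul, Complex.norm_real, Real.norm_of_nonneg (by positivity)]
            gcongr
            calc (4 : ℝ) ^ i = ((16 : ℝ) ^ i) ^ (1 / 2 : ℝ) := by
                  rw [← Real.sqrt_eq_rpow, show (16 : ℝ) ^ i = (4 ^ i) ^ 2 by
                    rw [← pow_mul, mul_comm, pow_mul]; norm_num, Real.sqrt_sq (by positivity)]
              _ ≤ _ := by gcongr; exact hvnorm i
    refine le_trans (le_of_eq ?_) (mul_le_mul_right h2 _)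
    rw [← mul_assoc, ← ENNReal.ofReal_mul (by positivity)]
    congr 2
    rw [mul_left_comm, ← mul_pow, mul_comm]
    norm_num
  have hlim : Filter.Tendsto (fun i : ℕ => ENNReal.ofReal (2 ^ i * κ) *
      eLpNorm (gaussianExp 2) q volume) Filter.atTop (nhds ⊤) := by
    have h1 : Filter.Tendsto (fun i : ℕ => ENNReal.ofReal (2 ^ i * κ)) Filter.atTop (nhds ⊤) :=
      ENNReal.tendsto_ofReal_atTop.comp
        ((tendsto_pow_atTop_atTop_of_one_lt one_lt_two).atTop_mul_const hκ)
    simpa [ENNReal.top_mul hpos] using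
      ENNReal.Tendsto.mul_const h1 (b := eLpNorm (gaussianExp 2) q volume) (Or.inl ENNReal.top_ne_zero)
  exact absurd (le_of_tendsto hlim hgrow) hfin.not_ge
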